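/- Let $n\ge 2$ be an integer and $q=2^n$ (so $q\ge 4$). Let $F$ be a field of characteristic $2$, let $\overline F$ be a separable algebraic closure of $F$, and let $0\neq a\in F$. Put $$T(x)=\sum_{i=0}^{n-1}x^{2^i-1},\qquad C(x)=x\,T(x)^{q+1}$$ (the Müller–Cohen–Matthews polynomial), and for a nonzero polynomial $f\in F[x]$ let $\mathrm{SF}(f;F)$ denote the subfield of $\overline F$ generated by $F$ and all the roots of $f$ in $\overline F$. Then the three polynomials $C(x)+a$, $x^{q+1}+x+1/a$ and $x^{q+1}+ax+a$ split into linear factors over $\overline F$, and $$\mathrm{SF}(C(x)+a;F)=\mathrm{SF}(x^{q+1}+x+1/a;F)=\mathrm{SF}(x^{q+1}+ax+a;F).$$ -/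

import Mathlib

open Polynomial

/-- `T(x) = ∑_{i=0}^{n-1} x^{2^i-1}`. -/
noncomputable def polyT (F : Type*) [Field F] (n : ℕ) : F[X] :=
  ∑ i ∈ Finset.range n, X ^ (2 ^ i - 1)

/-- The Müller–Cohen–Matthews polynomial `C(x) = x * T(x)^(q+1)`, where `q = 2^n`. -/
noncomputable def polyMCM (F : Type*) [Field F] (n : ℕ) : F[X] :=
  X * polyT F n ^ (2 ^ n + 1)

/-- `SF(f;F)`: the subfield of `Ω` generated by `F` and by all the roots of `f` in `Ω`. Here `Ω` is
meant to be a separable closure of `F`. -/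
noncomputable def SF {F : Type*} [Field F] (Ω : Type*) [Field Ω] [Algebra F Ω] (f : F[X]) :
    IntermediateField F Ω :=
  IntermediateField.adjoin F (f.rootSet Ω)

/-! Let φ be the q-power map and V the two-dimensional F_q-space of solutions of φ²y = a(φy + y).
The roots of x^(q+1) + ax + a are the quotients φy/y, one for each line of V. A twisted pair is a
vector of V ⊗ F_{q²} with its conjugate, off the F_q-rational lines. Its invariant is unchanged by
F_{q²}-scaling and by swapping, and the roots of C(x) + a are exactly these invariants, so they
correspond to unordered pairs of conjugate points of P¹(F_{q²}) outside P¹(F_q).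

An automorphism over F acts semilinearly on V. If it fixes every line, it is a homothety, trivial on
F_q, so it fixes each conjugate pair (`IsTwistedPair.map_invariant_eq`). If it fixes every conjugate
pair and q ≥ 4, comparing traces and norms shows that it is a homothety
(`exists_map_eq_mul_of_invariants_fixed`). Hence both sets of roots have the same pointwise
stabilizer, and the Galois correspondence identifies the fields. The two trinomials are related by u
= 1 + 1/x. -/

/-- A pair `(z, z')` of solutions of `φ² z = a (φ z' + z)`, `φ² z' = a (φ z + z')` that is
nondegenerate, for an endomorphism `φ` (later the `q`-power map). -/
structure IsTwistedPair {K : Type*} [Field K] (φ : K →+* K) (a z z' : K) : Prop where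
  eq_left : φ (φ z) = a * (φ z' + z)
  eq_right : φ (φ z') = a * (φ z + z')
  ne : z * φ z + z' * φ z' ≠ 0

/-- The quantity attached to a pair that parametrizes the roots of `C(x) + a`. -/
def pairInvariant {K : Type*} [Field K] (φ : K →+* K) (z z' : K) : K :=
  z * z' * φ (z * z') / (z * φ z + z' * φ z') ^ 2

/-! ### Identities satisfied by a twisted pair -/

section Abstract

variable {K : Type*} [Field K] {φ : K →+* K} {a z z' : K}

theorem IsTwistedPair.symm (h : IsTwistedPair φ a z z') : IsTwistedPair φ a z' z :=
  ⟨h.eq_right, h.eq_left, by rw [add_comm]; exact h.ne⟩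

theorem IsTwistedPair.left_ne_zero (h : IsTwistedPair φ a z z') (ha : a ≠ 0) : z ≠ 0 := by
  rintro rfl
  have h1 := h.eq_left
  have h2 := h.ne
  simp only [map_zero, zero_mul, add_zero, zero_add] at h1 h2
  have : φ z' = 0 := by
    rcases mul_eq_zero.mp h1.symm with h | h
    · exact absurd h ha
    · exact h
  exact h2 (by rw [this, mul_zero])

theorem IsTwistedPair.right_ne_zero (h : IsTwistedPair φ a z z') (ha : a ≠ 0) : z' ≠ 0 :=
  h.symm.left_ne_zero ha

theorem IsTwistedPair.map_left (h : IsTwistedPair φ a z z') :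
    φ (z * φ z) = a * (φ (z * z') + z * φ z) := by
  rw [map_mul, map_mul, h.eq_left]; ring

theorem pairInvariant_swap : pairInvariant φ z' z = pairInvariant φ z z' := by
  unfold pairInvariant
  rw [mul_comm z' z, add_comm (z' * φ z')]

variable [CharP K 2]

theorem IsTwistedPair.map_sum (h : IsTwistedPair φ a z z') :
    φ (z * φ z + z' * φ z') = a * (z * φ z + z' * φ z') := by
  rw [map_add, h.map_left, h.symm.map_left, mul_comm z' z]; grind

theorem IsTwistedPair.param_add (h : IsTwistedPair φ a z z') (ha : a ≠ 0) :
    z * φ z / (z * φ z + z' * φ z') + φ (z * φ z / (z * φ z + z' * φ z')) =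
      φ (z * z') / (z * φ z + z' * φ z') := by
  have hS := h.ne
  rw [map_div₀, h.map_sum, h.map_left]
  field_simp
  grind

/-- Put S = zφ(z) + z'φ(z') and s = zφ(z)/S. In characteristic 2, s + 1 = z'φ(z')/S, so the
invariant is s(s + 1). -/
theorem IsTwistedPair.param_sq_add (h : IsTwistedPair φ a z z') :
    (z * φ z / (z * φ z + z' * φ z')) ^ 2 + z * φ z / (z * φ z + z' * φ z') =
      pairInvariant φ z z' := by
  have hS := h.ne
  unfold pairInvariant
  rw [map_mul]
  field_simp
  grind

theorem IsTwistedPair.param_equation (h : IsTwistedPair φ a z z') (ha : a ≠ 0) {s : K}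
    (hs : s = z * φ z / (z * φ z + z' * φ z')) :
    (s + φ s) * φ (s + φ s) = a * φ (s ^ 2 + s) := by
  have hS := h.ne
  rw [hs, h.param_sq_add, h.param_add ha, map_div₀, h.map_sum, pairInvariant, map_div₀, map_pow,
    h.map_sum, map_mul φ (z * z') (φ (z * z'))]
  field_simp

/-- The point is that φ(z')/z depends only on v; this makes v determine the pair up to scaling. -/
theorem IsTwistedPair.ratio_right (h : IsTwistedPair φ a z z') (ha : a ≠ 0) {v : K}
    (hv : z' * φ z' = v * (z * φ z)) : φ z' * (1 + φ v) = z * (v + φ v) := by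
  have hz := h.left_ne_zero ha
  have hφz : φ z ≠ 0 := (map_ne_zero φ).mpr hz
  have h1 := h.map_left
  have h2 := h.symm.map_left
  rw [hv, map_mul, mul_comm z' z] at h2
  rw [map_mul φ z z'] at h1 h2
  have h3 : a * z * φ z * φ z * (φ z' * (1 + φ v) - z * (v + φ v)) = 0 := by
    have : φ (z * φ z) * (v + φ v) = a * (φ z * φ z') * (1 + v) := by grind
    grind
  rcases mul_eq_zero.mp h3 with h4 | h4
  · exact absurd h4 (by positivity)
  · exact sub_eq_zero.mp h4

end Abstract

/-! ### Rigidity of pairs; from fixed lines to fixed invariants -/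

section Abstract

variable {K : Type*} [Field K] {φ : K →+* K} {a z z' Z Z' : K}

theorem IsTwistedPair.map (h : IsTwistedPair φ a z z') {σ : K →+* K}
    (hσ : ∀ x, σ (φ x) = φ (σ x)) (ha : σ a = a) : IsTwistedPair φ a (σ z) (σ z') where
  eq_left := by rw [← hσ, ← hσ, ← hσ, h.eq_left, map_mul, map_add, ha]
  eq_right := by rw [← hσ, ← hσ, ← hσ, h.eq_right, map_mul, map_add, ha]
  ne := by
    rw [← hσ, ← hσ, ← map_mul, ← map_mul, ← map_add]
    exact (map_ne_zero σ).mpr h.ne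

theorem map_pairInvariant {σ : K →+* K} (hσ : ∀ x, σ (φ x) = φ (σ x)) :
    σ (pairInvariant φ z z') = pairInvariant φ (σ z) (σ z') := by
  simp only [pairInvariant, map_div₀, map_mul, map_pow, map_add, hσ]

variable [CharP K 2]

theorem IsTwistedPair.exists_mul_of_ratio (h : IsTwistedPair φ a z z')
    (H : IsTwistedPair φ a Z Z') (ha : a ≠ 0)
    (hr : (z * φ z) * (Z' * φ Z') = (z' * φ z') * (Z * φ Z)) :
    ∃ μ, μ ≠ 0 ∧ φ (φ μ) = μ ∧ Z = μ * z ∧ Z' = φ μ * z' := by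
  have hz := h.left_ne_zero ha
  have hz' := h.right_ne_zero ha
  have hZ := H.left_ne_zero ha
  have hφz : φ z ≠ 0 := (map_ne_zero φ).mpr hz
  have hφz' : φ z' ≠ 0 := (map_ne_zero φ).mpr hz'
  obtain ⟨v, hv⟩ : ∃ v, z' * φ z' = v * (z * φ z) :=
    ⟨z' * φ z' / (z * φ z), by field_simp⟩
  have hV : Z' * φ Z' = v * (Z * φ Z) := by
    apply mul_left_cancel₀ (mul_ne_zero hz hφz)
    rw [hr, hv]; ring
  have hv0 : v ≠ 0 := by
    rintro rfl
    rw [zero_mul] at hv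
    exact mul_ne_zero hz' hφz' hv
  have hv1 : 1 + φ v ≠ 0 := by
    intro h0
    have : φ (1 + v) = 0 := by rw [map_add, map_one, h0]
    apply h.ne
    rw [hv, ← one_add_mul, (map_eq_zero φ).mp this, zero_mul]
  have e1 := h.ratio_right ha hv
  have e2 := H.ratio_right ha hV
  have hv' : z * φ z = v⁻¹ * (z' * φ z') := by rw [hv]; field_simp
  have hV' : Z * φ Z = v⁻¹ * (Z' * φ Z') := by rw [hV]; field_simp
  have hw1 : 1 + φ v⁻¹ ≠ 0 := by
    rw [map_inv₀]
    intro h0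
    have := (map_ne_zero φ).mpr hv0
    apply hv1
    field_simp at h0
    rw [add_comm, h0, mul_zero]
  have e3 := h.symm.ratio_right ha hv'
  have e4 := H.symm.ratio_right ha hV'
  have k1 : φ Z' * z = φ z' * Z := by
    apply mul_right_cancel₀ hv1
    linear_combination z * e2 - Z * e1
  have k2 : φ Z * z' = φ z * Z' := by
    apply mul_right_cancel₀ hw1
    linear_combination z' * e4 - Z' * e3
  have hμ : φ (Z / z) = Z' / z' := by
    rw [map_div₀]
    field_simp
    linear_combination k2
  refine ⟨Z / z, div_ne_zero hZ hz, ?_, by field_simp, by rw [hμ]; field_simp⟩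
  rw [hμ, map_div₀]
  field_simp
  linear_combination k1

/-- With v = z'φ(z')/(zφ(z)) the invariant is v/(1 + v)², so it determines v up to inversion, and
inversion is the swap. -/
theorem IsTwistedPair.exists_mul_of_invariant_eq (h : IsTwistedPair φ a z z')
    (H : IsTwistedPair φ a Z Z') (ha : a ≠ 0)
    (he : pairInvariant φ z z' = pairInvariant φ Z Z') :
    ∃ μ, μ ≠ 0 ∧ φ (φ μ) = μ ∧
      (Z = μ * z ∧ Z' = φ μ * z' ∨ Z = μ * z' ∧ Z' = φ μ * z) := by
  have key : ((z * φ z) * (Z' * φ Z') - (z' * φ z') * (Z * φ Z)) *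
      ((z' * φ z') * (Z' * φ Z') - (z * φ z) * (Z * φ Z)) = 0 := by
    have h1 := h.ne
    have h2 := H.ne
    unfold pairInvariant at he
    rw [div_eq_div_iff (pow_ne_zero _ h1) (pow_ne_zero _ h2), map_mul, map_mul] at he
    grind
  rcases mul_eq_zero.mp key with k | k
  · obtain ⟨μ, h0, h1, h2⟩ := h.exists_mul_of_ratio H ha (sub_eq_zero.mp k)
    exact ⟨μ, h0, h1, Or.inl h2⟩
  · obtain ⟨μ, h0, h1, h2⟩ := h.symm.exists_mul_of_ratio H ha (sub_eq_zero.mp k)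
    exact ⟨μ, h0, h1, Or.inr h2⟩

/-- The second entry is forced: zφ(z) = sS, z'φ(z') = (1 + s)S and φ(zz') = (s + φ(s))S leave no
other choice. -/
theorem exists_isTwistedPair_of_param (ha : a ≠ 0) {s S : K} (hs : s ^ 2 + s ≠ 0)
    (h : (s + φ s) * φ (s + φ s) = a * φ (s ^ 2 + s)) (hS0 : S ≠ 0) (hS : φ S = a * S)
    (hz : z * φ z = s * S) :
    IsTwistedPair φ a z (φ z * (1 + s) / (s + φ s)) ∧
      pairInvariant φ z (φ z * (1 + s) / (s + φ s)) = s ^ 2 + s := by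
  have hs0 : s ≠ 0 := by rintro rfl; simp at hs
  have hs1 : 1 + s ≠ 0 := by
    intro h0
    apply hs
    linear_combination s * h0
  have hφs : φ s ≠ 0 := (map_ne_zero φ).mpr hs0
  have hφs1 : 1 + φ s ≠ 0 := by
    rw [← map_one φ, ← map_add]
    exact (map_ne_zero φ).mpr hs1
  have hne : s + φ s ≠ 0 := by
    intro h0
    rw [h0, zero_mul] at h
    exact mul_ne_zero ha ((map_ne_zero φ).mpr hs) h.symm
  have hne' : φ (s + φ s) ≠ 0 := (map_ne_zero φ).mpr hne
  have hz0 : z ≠ 0 := by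
    rintro rfl
    rw [zero_mul] at hz
    exact mul_ne_zero hs0 hS0 hz.symm
  have hφz : φ z ≠ 0 := (map_ne_zero φ).mpr hz0
  have hA : φ z * φ (φ z) = φ s * (a * S) := by
    rw [← map_mul, hz, map_mul, hS]
  set z' := φ z * (1 + s) / (s + φ s) with hz'
  have hφz' : φ z' = φ (φ z) * (1 + φ s) / φ (s + φ s) := by
    rw [hz', map_div₀, map_mul, map_add φ 1, map_one]
  clear_value z'
  have hφs2 : φ (s ^ 2 + s) = φ s * (1 + φ s) := by rw [map_add, map_pow]; ring
  rw [hφs2] at h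
  have hN : φ z * φ z' = S * (s + φ s) := by
    rw [hφz', ← mul_div_assoc, ← mul_assoc, hA, div_eq_iff hne']
    linear_combination -S * h
  have hB : z' * φ z' = (1 + s) * S := by
    have : z' * φ z' = φ z * φ (φ z) * ((1 + s) * (1 + φ s)) /
        ((s + φ s) * φ (s + φ s)) := by
      rw [hφz', hz', div_mul_div_comm]
      congr 1
      ring
    rw [this, hA, h]
    field_simp
  have hz'0 : z' ≠ 0 := by
    intro h0
    rw [h0, zero_mul] at hB
    exact mul_ne_zero hs1 hS0 hB.symm
  have hφz'0 : φ z' ≠ 0 := (map_ne_zero φ).mpr hz'0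
  have hB' : φ z' * φ (φ z') = (1 + φ s) * (a * S) := by
    rw [← map_mul, hB, map_mul, hS, map_add, map_one]
  have hsum : z * φ z + z' * φ z' = S := by rw [hz, hB]; grind
  refine ⟨⟨?_, ?_, by rw [hsum]; exact hS0⟩, ?_⟩
  · apply mul_left_cancel₀ hφz
    rw [hA]
    grind
  · apply mul_left_cancel₀ hφz'0
    rw [hB']
    linear_combination -a * hN - a * hB - a * S * CharTwo.add_self_eq_zero s
  · rw [pairInvariant, hsum, map_mul, div_eq_iff (pow_ne_zero _ hS0)]
    linear_combination (z' * φ z') * hz + s * S * hB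

theorem IsTwistedPair.eq_zero_of_combination_eq_zero (h : IsTwistedPair φ a z z') {u : K}
    (hu : φ (φ u) = u) (h0 : u * z + φ u * z' = 0) : u = 0 := by
  have h1 : φ u * φ z + u * φ z' = 0 := by
    rw [← map_zero φ, ← h0, map_add, map_mul, map_mul, hu]
  by_contra hne
  have h2 : u * φ u * (z * φ z + z' * φ z') = 0 := by grind
  exact mul_ne_zero (mul_ne_zero hne ((map_ne_zero φ).mpr hne)) h.ne h2

/-- An endomorphism stabilizing all `φ`-fixed lines in the solution space of
`φ² y = a (φ y + y)` fixes the invariant of each pair. -/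
theorem IsTwistedPair.map_invariant_eq (h : IsTwistedPair φ a z z') {σ : K →+* K}
    (hσ : ∀ x, σ (φ x) = φ (σ x)) {w : K} (hw : φ w = w + 1)
    (hlin : ∀ y, y ≠ 0 → φ (φ y) = a * (φ y + y) → ∃ l, φ l = l ∧ σ y = l * y) :
    σ (pairInvariant φ z z') = pairInvariant φ z z' := by
  have hww : φ (φ w) = w := by rw [hw, map_add, map_one, hw]; grind
  have hsol : ∀ u, φ (φ u) = u → u ≠ 0 →
      ∃ l, φ l = l ∧ σ (u * z + φ u * z') = l * (u * z + φ u * z') := by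
    intro u hu hu0
    apply hlin
    · exact fun h0 => hu0 (h.eq_zero_of_combination_eq_zero hu h0)
    · simp only [map_add, map_mul, hu, h.eq_left, h.eq_right]
      ring
  -- The combination equals uz + φ(u)z' with u = α + βw.
  have hind : ∀ α β, φ α = α → φ β = β →
      α * (z + z') + β * (w * z + φ w * z') = 0 → α = 0 ∧ β = 0 := by
    intro α β hα hβ h0
    have hφu : φ (α + β * w) = α + β * φ w := by rw [map_add, map_mul, hα, hβ]
    have hu : α + β * w = 0 := by
      apply h.eq_zero_of_combination_eq_zero
      · rw [hφu, map_add, map_mul, hα, hβ, hww]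
      · rw [hφu]; linear_combination h0
    have hβ0 : β = 0 := by
      have : α + β * φ w = 0 := by rw [← hφu, hu, map_zero]
      rw [hw] at this
      linear_combination this - hu
    refine ⟨?_, hβ0⟩
    rw [hβ0] at hu
    linear_combination hu
  have hw0 : w ≠ 0 := by
    rintro rfl
    simp at hw
  set c := w ^ 2 + w with hc
  have hφc : φ c = c := by rw [hc, map_add, map_pow, hw]; grind
  have hcw : 1 + c * w ≠ 0 := by
    intro h0
    have h1 : φ (1 + c * w) = 0 := by rw [h0, map_zero]
    rw [map_add, map_one, map_mul, hφc, hw] at h1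
    have : c = 0 := by linear_combination h1 - h0
    rw [this] at h0
    simp at h0
  -- Let e₁ = z + z' and e₂ = wz + φ(w)z'. The lines of e₁, e₂ and e₁ + e₂ force a common factor l;
  -- the line of e₁ + ce₂ then forces σ(c) = c.
  obtain ⟨l, hl, e1⟩ := hsol 1 (by simp) one_ne_zero
  obtain ⟨m, hm, e2⟩ := hsol w hww hw0
  obtain ⟨k, hk, e3⟩ := hsol (1 + w) (by rw [map_add, map_add, hww]; simp) (by
    intro h0
    have h1 : φ (1 + w) = 0 := by rw [h0, map_zero]
    rw [map_add, map_one, hw] at h1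
    exact one_ne_zero (α := K) (by linear_combination h1 - h0))
  obtain ⟨j, hj, e4⟩ := hsol (1 + c * w)
    (by rw [map_add, map_add, map_mul, map_mul, hφc, hφc, hww]; simp) hcw
  have hσc : φ (σ c) = σ c := by rw [← hσ, hφc]
  simp only [map_one, one_mul] at e1
  have hkl := hind (l - k) (m - k) (by simp [hl, hk]) (by simp [hm, hk]) (by
    rw [map_add φ, map_one] at e3
    have : (1 + w) * z + (1 + φ w) * z' = (z + z') + (w * z + φ w * z') := by ring
    rw [this, map_add, e1, e2] at e3
    linear_combination e3)
  have hml : m = l := by linear_combination hkl.2 - hkl.1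
  rw [hml] at e2
  have hjl := hind (l - j) (σ c * l - j * c) (by simp [hl, hj]) (by simp [hl, hj, hσc, hφc]) (by
    rw [map_add φ, map_one, map_mul φ, hφc] at e4
    have : (1 + c * w) * z + (1 + c * φ w) * z' = (z + z') + c * (w * z + φ w * z') := by ring
    rw [this, map_add, map_mul, e1, e2] at e4
    linear_combination e4)
  have hl0 : l ≠ 0 := by
    rintro rfl
    rw [zero_mul, map_eq_zero] at e1
    exact one_ne_zero (h.eq_zero_of_combination_eq_zero (u := 1) (by simp) (by simpa using e1))
  have hcc : σ c = c := by
    apply mul_right_cancel₀ hl0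
    linear_combination hjl.2 - c * hjl.1
  -- Both w and σ(w) are roots of X² + X + c.
  have hwcase : (σ w - w) * (σ w - (w + 1)) = 0 := by
    rw [hc, map_add, map_pow] at hcc
    grind
  rw [map_pairInvariant hσ]
  have hinv : ∀ x y, pairInvariant φ (l * x) (l * y) = pairInvariant φ x y := by
    intro x y
    unfold pairInvariant
    simp only [map_mul, hl]
    have : l * x * (l * φ x) + l * y * (l * φ y) = l ^ 2 * (x * φ x + y * φ y) := by ring
    rw [this, mul_pow, show l * x * (l * y) * (l * φ x * (l * φ y)) =
      (l ^ 2) ^ 2 * (x * y * (φ x * φ y)) by ring,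
      mul_div_mul_left _ _ (pow_ne_zero 2 (pow_ne_zero 2 hl0))]
  rw [map_add, hw, map_mul, map_mul, map_add, map_one] at e2
  rw [map_add] at e1
  rcases mul_eq_zero.mp hwcase with hw1 | hw1
  · have hw2 : σ w = w := sub_eq_zero.mp hw1
    rw [hw2] at e2
    have i2 : σ z' = l * z' := by linear_combination e2 - w * e1
    have i1 : σ z = l * z := by linear_combination e1 - i2
    rw [i1, i2, hinv]
  · have hw2 : σ w = w + 1 := sub_eq_zero.mp hw1
    rw [hw2] at e2
    have i1 : σ z = l * z' := by grind
    have i2 : σ z' = l * z := by linear_combination e1 - i1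
    rw [i1, i2, hinv, pairInvariant_swap]

end Abstract

/-! ### The solution space; from fixed invariants to fixed lines -/

section Abstract

variable {K : Type*} [Field K] {φ : K →+* K} {a y₁ y₂ : K}

theorem map_moore_det (h₁ : φ (φ y₁) = a * (φ y₁ + y₁)) (h₂ : φ (φ y₂) = a * (φ y₂ + y₂))
    [CharP K 2] : φ (y₁ * φ y₂ + y₂ * φ y₁) = a * (y₁ * φ y₂ + y₂ * φ y₁) := by
  rw [map_add, map_mul, map_mul, h₁, h₂]; grind

variable [CharP K 2]

/-- Two solutions with nonvanishing Moore determinant span the solution space over the fixed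
field of `φ`. -/
theorem exists_coordinates (ha : a ≠ 0) (h₁ : φ (φ y₁) = a * (φ y₁ + y₁))
    (h₂ : φ (φ y₂) = a * (φ y₂ + y₂)) (hΔ : y₁ * φ y₂ + y₂ * φ y₁ ≠ 0) {y : K}
    (h : φ (φ y) = a * (φ y + y)) :
    ∃ α β, φ α = α ∧ φ β = β ∧ y = α * y₁ + β * y₂ := by
  refine ⟨(y * φ y₂ + y₂ * φ y) / (y₁ * φ y₂ + y₂ * φ y₁),
    (y₁ * φ y + y * φ y₁) / (y₁ * φ y₂ + y₂ * φ y₁), ?_, ?_, ?_⟩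
  · rw [map_div₀, map_moore_det h h₂, map_moore_det h₁ h₂, mul_div_mul_left _ _ ha]
  · rw [map_div₀, map_moore_det h₁ h, map_moore_det h₁ h₂, mul_div_mul_left _ _ ha]
  · field_simp
    grind

theorem eq_zero_of_combination_eq_zero (ha : a ≠ 0) (h₁ : φ (φ y₁) = a * (φ y₁ + y₁))
    (h₂ : φ (φ y₂) = a * (φ y₂ + y₂)) (hΔ : y₁ * φ y₂ + y₂ * φ y₁ ≠ 0) {α β : K}
    (hα : φ (φ α) = α) (hβ : φ (φ β) = β) (h : α * y₁ + β * y₂ = 0) : α = 0 ∧ β = 0 := by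
  have h' : α * φ y₁ + β * φ y₂ = 0 := by
    have : φ (φ (α * y₁ + β * y₂)) = 0 := by rw [h, map_zero, map_zero]
    simp only [map_add, map_mul, hα, hβ, h₁, h₂] at this
    apply mul_left_cancel₀ ha
    linear_combination this - a * h
  constructor
  · apply mul_right_cancel₀ hΔ
    grind
  · apply mul_right_cancel₀ hΔ
    grind

theorem isTwistedPair_of_basis (h₁ : φ (φ y₁) = a * (φ y₁ + y₁))
    (h₂ : φ (φ y₂) = a * (φ y₂ + y₂)) (hΔ : y₁ * φ y₂ + y₂ * φ y₁ ≠ 0) {w : K}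
    (hw : φ (φ w) = w) (hne : φ w ≠ w) :
    IsTwistedPair φ a (y₁ + w * y₂) (y₁ + φ w * y₂) where
  eq_left := by simp only [map_add, map_mul, hw, h₁, h₂]; ring
  eq_right := by simp only [map_add, map_mul, hw, h₁, h₂]; ring
  ne := by
    have : (φ w - w) * (y₁ * φ y₂ + y₂ * φ y₁) ≠ 0 := mul_ne_zero (sub_ne_zero.mpr hne) hΔ
    simp only [map_add, map_mul, hw]
    convert this using 1
    grind

/-- If an endomorphism fixes all pair invariants, then its (semilinear) matrix on the solution
space acts trivially on conjugate pairs `{w, φ w}`. -/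
theorem exists_conjugate_of_invariants_fixed (ha : a ≠ 0) (h₁ : φ (φ y₁) = a * (φ y₁ + y₁))
    (h₂ : φ (φ y₂) = a * (φ y₂ + y₂)) (hΔ : y₁ * φ y₂ + y₂ * φ y₁ ≠ 0) {σ : K →+* K}
    (hσ : ∀ x, σ (φ x) = φ (σ x)) (hσa : σ a = a)
    (hinv : ∀ z z', IsTwistedPair φ a z z' →
      σ (pairInvariant φ z z') = pairInvariant φ z z')
    {α β γ δ : K} (hα : φ α = α) (hβ : φ β = β) (hγ : φ γ = γ) (hδ : φ δ = δ)
    (e₁ : σ y₁ = α * y₁ + β * y₂) (e₂ : σ y₂ = γ * y₁ + δ * y₂)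
    {w : K} (hw : φ (φ w) = w) (hne : φ w ≠ w) :
    ∃ u, (u = w ∨ u = φ w) ∧ α + γ * σ w ≠ 0 ∧ β + δ * σ w = (α + γ * σ w) * u := by
  have hp := isTwistedPair_of_basis h₁ h₂ hΔ hw hne
  have hσw : φ (φ (σ w)) = σ w := by rw [← hσ, ← hσ, hw]
  have key : ∀ u μ, φ (φ u) = u → φ (φ μ) = μ → μ ≠ 0 → σ (y₁ + w * y₂) = μ * (y₁ + u * y₂) →
      α + γ * σ w ≠ 0 ∧ β + δ * σ w = (α + γ * σ w) * u := by
    intro u μ hu hμ hμ0 h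
    rw [map_add, map_mul, e₁, e₂] at h
    obtain ⟨k₁, k₂⟩ := eq_zero_of_combination_eq_zero ha h₁ h₂ hΔ
      (α := α + γ * σ w - μ) (β := β + δ * σ w - μ * u)
      (by simp only [map_sub, map_add, map_mul, hα, hγ, hσw, hμ])
      (by simp only [map_sub, map_add, map_mul, hβ, hδ, hσw, hμ, hu])
      (by linear_combination h)
    rw [sub_eq_zero] at k₁ k₂
    rw [k₁, k₂]
    exact ⟨hμ0, rfl⟩
  obtain ⟨μ, hμ0, hμ, h | h⟩ := hp.exists_mul_of_invariant_eq (hp.map hσ hσa) ha (by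
    rw [← map_pairInvariant hσ, hinv _ _ hp])
  · exact ⟨w, Or.inl rfl, key w μ hw hμ hμ0 h.1⟩
  · exact ⟨φ w, Or.inr rfl, key (φ w) μ (by rw [hw]) hμ hμ0 h.1⟩

/-- An endomorphism that fixes the invariants of all pairs is a homothety on the solution space. -/
theorem exists_map_eq_mul_of_invariants_fixed (ha : a ≠ 0)
    (h₁ : φ (φ y₁) = a * (φ y₁ + y₁))
    (h₂ : φ (φ y₂) = a * (φ y₂ + y₂)) (hΔ : y₁ * φ y₂ + y₂ * φ y₁ ≠ 0) {σ : K →+* K}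
    (hσ : ∀ x, σ (φ x) = φ (σ x)) (hσa : σ a = a)
    (hinv : ∀ z z', IsTwistedPair φ a z z' →
      σ (pairInvariant φ z z') = pairInvariant φ z z')
    {w c : K} (hw : φ w = w + 1) (hc : φ c = c) (hc0 : c ≠ 0) (hc1 : c ≠ 1) :
    ∃ l, l ≠ 0 ∧ φ l = l ∧ σ y₁ = l * y₁ := by
  have hσsol : ∀ y, φ (φ y) = a * (φ y + y) → φ (φ (σ y)) = a * (φ (σ y) + σ y) := by
    intro y h
    rw [← hσ, ← hσ, h, map_mul, map_add, hσa]
  obtain ⟨α, β, hα, hβ, e₁⟩ := exists_coordinates ha h₁ h₂ hΔ (hσsol _ h₁)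
  obtain ⟨γ, δ, hγ, hδ, e₂⟩ := exists_coordinates ha h₁ h₂ hΔ (hσsol _ h₂)
  have hww : φ (φ w) = w := by rw [hw, map_add, map_one, hw]; grind
  have hfix : ∀ x, φ x = x → φ (σ x) = σ x := fun x hx => by rw [← hσ, hx]
  have hσw : φ (σ w) = σ w + 1 := by rw [← hσ, hw, map_add, map_one]
  -- norm and trace of the action on `t * w + d`
  have main : ∀ t d, t ≠ 0 → φ t = t → φ d = d →
      σ t * (α * δ + β * γ) = t * (α ^ 2 + α * γ * σ t + γ ^ 2 *
        σ ((t * w + d) * (t * w + d + t))) ∧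
      β ^ 2 + β * δ * σ t + δ ^ 2 * σ ((t * w + d) * (t * w + d + t)) =
        ((t * w + d) * (t * w + d + t)) *
          (α ^ 2 + α * γ * σ t + γ ^ 2 * σ ((t * w + d) * (t * w + d + t))) ∧
      α + γ * σ (t * w + d) ≠ 0 := by
    intro t d ht0 ht hd
    have hφu : φ (t * w + d) = t * w + d + t := by rw [map_add, map_mul, hw, ht, hd]; ring
    generalize t * w + d = x at hφu ⊢
    have hφx : φ (φ x) = x := by rw [hφu, map_add, hφu, ht]; grind
    obtain ⟨u, hu, hne, he⟩ := exists_conjugate_of_invariants_fixed ha h₁ h₂ hΔ hσ hσa hinv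
      hα hβ hγ hδ e₁ e₂ hφx (by rw [hφu]; simpa using ht0)
    have hσx : φ (σ x) = σ x + σ t := by rw [← hσ, hφu, map_add]
    have he' : β + δ * (σ x + σ t) = (α + γ * (σ x + σ t)) * φ u := by
      have := congrArg φ he
      simpa only [map_add, map_mul, hα, hβ, hγ, hδ, hσx] using this
    -- The image u of x is x or its conjugate, so trace and norm agree. Clearing denominators in
    -- these two equalities gives the two identities.
    have hut : u + φ u = t ∧ u * φ u = x * (x + t) := by
      rcases hu with rfl | rfl
      · rw [hφu]; exact ⟨by grind, rfl⟩
      · rw [hφx, hφu]; exact ⟨by grind, by ring⟩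
    obtain ⟨hsum, hprod⟩ := hut
    simp only [map_mul, map_add] at *
    refine ⟨?_, ?_, hne⟩
    · have k1 : (β + δ * σ x) * (α + γ * (σ x + σ t)) +
          (β + δ * (σ x + σ t)) * (α + γ * σ x) =
          (α + γ * σ x) * (α + γ * (σ x + σ t)) * t := by
        rw [he, he', ← hsum]; ring
      grind
    · have k2 : (β + δ * σ x) * (β + δ * (σ x + σ t)) =
          (α + γ * σ x) * (α + γ * (σ x + σ t)) * (x * (x + t)) := by
        rw [he, he', ← hprod]; ring
      grind
  obtain ⟨m₁, -, m₃⟩ := main 1 0 one_ne_zero (map_one φ) (map_zero φ)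
  obtain ⟨n₁, -, -⟩ := main 1 c one_ne_zero (map_one φ) hc
  -- The norms of w and w + c differ by c(c + 1), so subtracting the trace identities leaves γ²σ(c(c
  -- + 1)) = 0.
  have hγ0 : γ = 0 := by
    have hcc : σ (c * (c + 1)) ≠ 0 := by
      rw [_root_.map_ne_zero]
      refine mul_ne_zero hc0 fun h0 => hc1 ?_
      grind
    simp only [map_one, map_mul, map_add, map_zero] at m₁ n₁ hcc
    have : γ ^ 2 * (σ c * (σ c + 1)) = 0 := by grind
    rcases mul_eq_zero.mp this with h | h
    · simpa using h
    · exact absurd h hcc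
  subst hγ0
  have hα0 : α ≠ 0 := by simpa using m₃
  have hδα : δ = α := by
    simp only [map_one] at m₁
    apply mul_left_cancel₀ hα0
    linear_combination m₁
  subst hδα
  have hσt : ∀ t, φ t = t → σ t = t := by
    intro t ht
    rcases eq_or_ne t 0 with rfl | ht0
    · exact map_zero σ
    · have := (main t 0 ht0 ht (map_zero φ)).1
      apply mul_right_cancel₀ (pow_ne_zero 2 hα0)
      linear_combination this
  -- Here σ fixes the norm of tw, so the norm identity keeps only its terms in β. Taking t = 1 and t
  -- = c then excludes β ≠ 0.
  have hβt : ∀ t, t ≠ 0 → φ t = t → β * (β + t * δ) = 0 := by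
    intro t ht0 ht
    have := (main t 0 ht0 ht (map_zero φ)).2.1
    rw [hσt t ht, hσt ((t * w + 0) * (t * w + 0 + t))] at this
    · linear_combination this
    · simp only [map_add, map_mul, map_zero, hw, ht]
      grind
  have hβ0 : β = 0 := by
    have b₁ := hβt 1 one_ne_zero (map_one φ)
    have b₂ := hβt c hc0 hc
    by_contra hne
    have k₁ := (mul_eq_zero.mp b₁).resolve_left hne
    have k₂ := (mul_eq_zero.mp b₂).resolve_left hne
    have : (c - 1) * δ = 0 := by linear_combination k₂ - k₁
    exact mul_ne_zero (sub_ne_zero.mpr hc1) hα0 this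
  refine ⟨δ, hα0, hα, ?_⟩
  rw [e₁, hβ0]
  ring

end Abstract

/-! ### Separability and the Galois correspondence -/

theorem Polynomial.separable_of_eq_mul_derivative_add_C {K : Type*} [Field K] {f g : K[X]} {b : K}
    (hb : b ≠ 0) (h : f = g * derivative f + C b) : f.Separable := by
  refine ⟨C b⁻¹, -C b⁻¹ * g, ?_⟩
  have : C b⁻¹ * C b = (1 : K[X]) := by rw [← C_mul, inv_mul_cancel₀ hb, C_1]
  linear_combination C b⁻¹ * h + this

theorem IsSepClosed.exists_root_notMem {K : Type*} [Field K] [IsSepClosed K] {f : K[X]}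
    (hf : f.Separable) (S : Finset K) (hS : S.card < f.natDegree) : ∃ x, f.IsRoot x ∧ x ∉ S := by
  classical
  have hcard : f.roots.toFinset.card = f.natDegree := by
    rw [Multiset.toFinset_card_of_nodup (nodup_roots hf),
      (IsSepClosed.splits_of_separable f hf).natDegree_eq_card_roots]
  obtain ⟨x, hx, hxS⟩ := Finset.exists_mem_notMem_of_card_lt_card (hcard.symm ▸ hS)
  exact ⟨x, (mem_roots'.mp (Multiset.mem_toFinset.mp hx)).2, hxS⟩

theorem IntermediateField.adjoin_eq_adjoin_of_fixes_iff {F E : Type*} [Field F] [Field E]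
    [Algebra F E] [IsGalois F E] {S T : Set E}
    (h : ∀ σ : Gal(E/F), (∀ x ∈ S, σ x = x) ↔ ∀ x ∈ T, σ x = x) :
    IntermediateField.adjoin F S = IntermediateField.adjoin F T := by
  have hmem : ∀ (S : Set E) (σ : Gal(E/F)),
      σ ∈ (IntermediateField.adjoin F S).fixingSubgroup ↔ ∀ x ∈ S, σ x = x := by
    intro S σ
    rw [IntermediateField.mem_fixingSubgroup_iff]
    constructor
    · exact fun h x hx => h x (IntermediateField.subset_adjoin F S hx)
    · intro h x hx
      induction hx using IntermediateField.adjoin_induction with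
      | mem x hx => exact h x hx
      | algebraMap x => exact σ.commutes x
      | add x y _ _ hx hy => rw [map_add, hx, hy]
      | inv x _ hx => rw [map_inv₀, hx]
      | mul x y _ _ hx hy => rw [map_mul, hx, hy]
  rw [← InfiniteGalois.fixedField_fixingSubgroup (IntermediateField.adjoin F S),
    ← InfiniteGalois.fixedField_fixingSubgroup (IntermediateField.adjoin F T)]
  congr 1
  ext σ
  rw [hmem, hmem, h]

/-! ### The polynomials in characteristic 2 -/

section CharTwo

variable {F : Type*} [Field F]

theorem X_mul_polyT (n : ℕ) : X * polyT F n = ∑ i ∈ Finset.range n, X ^ 2 ^ i := by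
  rw [polyT, Finset.mul_sum]
  refine Finset.sum_congr rfl fun i _ => ?_
  rw [← pow_succ', Nat.sub_add_cancel Nat.one_le_two_pow]

theorem map_polyT {Ω : Type*} [Field Ω] [Algebra F Ω] (n : ℕ) :
    (polyT F n).map (algebraMap F Ω) = polyT Ω n := by
  simp [polyT, Polynomial.map_sum]

variable [CharP F 2]

theorem derivative_X_mul_polyT {n : ℕ} (hn : n ≠ 0) : derivative (X * polyT F n) = 1 := by
  rw [X_mul_polyT, derivative_sum, Finset.sum_eq_single_of_mem 0 (by simp; omega)]
  · simp
  · intro i _ hi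
    rw [derivative_X_pow, Nat.cast_pow, Nat.cast_ofNat, CharTwo.two_eq_zero, zero_pow hi]
    simp

/-- The sum of the powers (s² + s)^(2^i) telescopes. -/
theorem eval_mul_eval_polyT (n : ℕ) (s : F) :
    (s ^ 2 + s) * (polyT F n).eval (s ^ 2 + s) = s ^ 2 ^ n + s := by
  have h : (X * polyT F n).eval (s ^ 2 + s) = s ^ 2 ^ n + s := by
    rw [X_mul_polyT, eval_finsetSum]
    simp only [eval_pow, eval_X]
    induction n with
    | zero => simp [CharTwo.add_self_eq_zero]
    | succ n ih =>
      rw [Finset.sum_range_succ, ih, add_pow_char_pow, ← pow_mul, ← pow_succ']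
      grind
  simpa using h

/-- Since (xT)' = 1, the derivative of C is T^q, and C = xT · C'. -/
theorem separable_polyMCM_add_C {n : ℕ} (hn : n ≠ 0) {a : F} (ha : a ≠ 0) :
    (polyMCM F n + C a).Separable := by
  apply separable_of_eq_mul_derivative_add_C (g := X * polyT F n) ha
  have hq : ((2 : F[X]) ^ n) = 0 := by rw [CharTwo.two_eq_zero, zero_pow hn]
  have h := derivative_X_mul_polyT (F := F) hn
  rw [derivative_mul, derivative_X, one_mul] at h
  have : derivative (polyMCM F n + C a) = polyT F n ^ 2 ^ n := by
    rw [polyMCM, derivative_add, derivative_C, add_zero, derivative_mul, derivative_X,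
      derivative_pow_succ]
    push_cast
    simp only [C_add, C_pow, C_1, C_ofNat, hq]
    linear_combination polyT F n ^ 2 ^ n * h
  rw [this, polyMCM]
  ring

theorem separable_trinomial {n : ℕ} (hn : n ≠ 0) (b : F) {c : F} (hc : c ≠ 0) :
    (X ^ (2 ^ n + 1) + C b * X + C c : F[X]).Separable := by
  apply separable_of_eq_mul_derivative_add_C (g := X) hc
  have hq : ((2 : F[X]) ^ n) = 0 := by rw [CharTwo.two_eq_zero, zero_pow hn]
  simp only [derivative_add, derivative_X_pow_succ, derivative_C_mul, derivative_X, derivative_C]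
  push_cast
  simp only [C_add, C_pow, C_1, C_ofNat, hq]
  ring

end CharTwo

/-! ### Roots over a separably closed field -/

section SepClosed

variable {K : Type*} [Field K] [CharP K 2]

/-- With e = s² + s, multiply eT(e)^(q+1) = a by e^q and use eT(e) = s + φ(s). -/
theorem polyMCM_add_C_isRoot_iff {n : ℕ} {a s : K} (hs : s ^ 2 + s ≠ 0) :
    (polyMCM K n + C a).IsRoot (s ^ 2 + s) ↔
      (s + iterateFrobenius K 2 n s) * iterateFrobenius K 2 n (s + iterateFrobenius K 2 n s) =
        a * iterateFrobenius K 2 n (s ^ 2 + s) := by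
  have hT := eval_mul_eval_polyT n s
  simp only [iterateFrobenius_def]
  rw [IsRoot, eval_add, eval_C, polyMCM, eval_mul, eval_X, eval_pow,
    add_comm s (s ^ 2 ^ n), ← hT, ← pow_succ']
  have he : (s ^ 2 + s) ^ 2 ^ n ≠ 0 := pow_ne_zero _ hs
  generalize (polyT K n).eval (s ^ 2 + s) = t
  rw [mul_pow, pow_succ (s ^ 2 + s), mul_assoc, mul_comm a, mul_right_inj' he]
  rw [CharTwo.add_eq_zero]

variable {n : ℕ}

theorem natCast_two_pow_sub_one_ne_zero (hn : n ≠ 0) : ((2 ^ n - 1 : ℕ) : K) ≠ 0 := by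
  rw [Ne, CharP.cast_eq_zero_iff K 2]
  obtain ⟨m, rfl⟩ := Nat.exists_eq_succ_of_ne_zero hn
  have := Nat.one_le_two_pow (n := m)
  rw [pow_succ]
  omega

theorem natCast_two_pow_add_one_ne_zero (hn : n ≠ 0) : ((2 ^ n + 1 : ℕ) : K) ≠ 0 := by
  rw [Ne, CharP.cast_eq_zero_iff K 2]
  obtain ⟨m, rfl⟩ := Nat.exists_eq_succ_of_ne_zero hn
  rw [pow_succ]
  omega

variable {a : K}

theorem IsTwistedPair.isRoot_pairInvariant {z z' : K}
    (h : IsTwistedPair (iterateFrobenius K 2 n) a z z') (ha : a ≠ 0) :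
    (polyMCM K n + C a).IsRoot (pairInvariant (iterateFrobenius K 2 n) z z') := by
  have hne : pairInvariant (iterateFrobenius K 2 n) z z' ≠ 0 := by
    have := mul_ne_zero (h.left_ne_zero ha) (h.right_ne_zero ha)
    exact div_ne_zero (mul_ne_zero this ((_root_.map_ne_zero _).mpr this)) (pow_ne_zero 2 h.ne)
  rw [← h.param_sq_add] at hne ⊢
  exact (polyMCM_add_C_isRoot_iff hne).mpr (h.param_equation ha rfl)

theorem trinomial_isRoot_iff {b c x : K} :
    (X ^ (2 ^ n + 1) + C b * X + C c : K[X]).IsRoot x ↔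
      iterateFrobenius K 2 n x * x + b * x + c = 0 := by
  simp [IsRoot, iterateFrobenius_def, pow_succ]

variable [IsSepClosed K]

theorem exists_iterateFrobenius_eq_mul (hn : n ≠ 0) {x : K} (hx : x ≠ 0) :
    ∃ y, y ≠ 0 ∧ iterateFrobenius K 2 n y = x * y := by
  have : NeZero ((2 ^ n - 1 : ℕ) : K) := ⟨natCast_two_pow_sub_one_ne_zero hn⟩
  obtain ⟨y, rfl⟩ := IsSepClosed.exists_pow_nat_eq x (2 ^ n - 1)
  refine ⟨y, ?_, ?_⟩
  · rintro rfl
    apply hx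
    rw [zero_pow]
    intro h0
    exact this.out (by rw [h0, Nat.cast_zero])
  · rw [iterateFrobenius_def, ← pow_succ, Nat.sub_add_cancel Nat.one_le_two_pow]

theorem exists_mul_iterateFrobenius_eq (hn : n ≠ 0) (x : K) :
    ∃ z, z * iterateFrobenius K 2 n z = x := by
  have : NeZero ((2 ^ n + 1 : ℕ) : K) := ⟨natCast_two_pow_add_one_ne_zero hn⟩
  obtain ⟨z, hz⟩ := IsSepClosed.exists_pow_nat_eq x (2 ^ n + 1)
  exact ⟨z, by rw [iterateFrobenius_def, ← pow_succ', hz]⟩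

theorem exists_iterateFrobenius_add_self_eq (hn : n ≠ 0) (x : K) :
    ∃ w, iterateFrobenius K 2 n w + w = x := by
  obtain ⟨w, hw⟩ := IsSepClosed.exists_root_C_mul_X_pow_add_C_mul_X_add_C' 2 (2 ^ n) (1 : K) 1 x
    (dvd_pow_self 2 hn) (Nat.one_lt_two_pow hn) one_ne_zero
  refine ⟨w, CharTwo.add_eq_zero.mp ?_⟩
  rw [iterateFrobenius_def, ← hw, one_mul, one_mul]

/-- This is where q ≥ 4 matters: for q = 2 there is no such c, and C(x) + a = x + a carries no
information. -/
theorem exists_iterateFrobenius_eq_self (hn : 2 ≤ n) :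
    ∃ c : K, iterateFrobenius K 2 n c = c ∧ c ≠ 0 ∧ c ≠ 1 := by
  classical
  obtain ⟨c, hc, hcS⟩ := IsSepClosed.exists_root_notMem
    (galois_poly_separable (K := K) 2 (2 ^ n) (dvd_pow_self 2 (by omega))) {0, 1} (by
      rw [FiniteField.X_pow_card_sub_X_natDegree_eq K (Nat.one_lt_two_pow (by omega))]
      calc _ ≤ 2 := Finset.card_le_two
        _ < 2 ^ 2 := by norm_num
        _ ≤ 2 ^ n := Nat.pow_le_pow_right (by norm_num) hn)
  simp only [Finset.mem_insert, Finset.mem_singleton, not_or] at hcS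
  refine ⟨c, ?_, hcS⟩
  simpa [IsRoot, sub_eq_zero, iterateFrobenius_def] using hc

/-- Every root of `C(x) + a` is the invariant of a pair. -/
theorem exists_isTwistedPair_of_isRoot (hn : n ≠ 0) (ha : a ≠ 0) {e : K}
    (he : (polyMCM K n + C a).IsRoot e) :
    ∃ z z', IsTwistedPair (iterateFrobenius K 2 n) a z z' ∧
      pairInvariant (iterateFrobenius K 2 n) z z' = e := by
  have he0 : e ≠ 0 := by
    rintro rfl
    simp [polyMCM, IsRoot, ha] at he
  obtain ⟨s, rfl⟩ : ∃ s, s ^ 2 + s = e := by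
    obtain ⟨s, hs⟩ := exists_iterateFrobenius_add_self_eq (n := 1) one_ne_zero e
    exact ⟨s, by rwa [iterateFrobenius_def, pow_one] at hs⟩
  obtain ⟨S, hS0, hS⟩ := exists_iterateFrobenius_eq_mul hn ha
  obtain ⟨z, hz⟩ := exists_mul_iterateFrobenius_eq hn (s * S)
  exact ⟨z, _, exists_isTwistedPair_of_param ha he0 ((polyMCM_add_C_isRoot_iff he0).mp he)
    hS0 hS hz⟩

variable {σ : K →+* K}

theorem map_eq_self_of_fixes_trinomial_roots (hn : n ≠ 0) (ha : a ≠ 0)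
    (h : ∀ x, (X ^ (2 ^ n + 1) + C a * X + C a : K[X]).IsRoot x → σ x = x) {e : K}
    (he : (polyMCM K n + C a).IsRoot e) : σ e = e := by
  obtain ⟨z, z', hz, rfl⟩ := exists_isTwistedPair_of_isRoot hn ha he
  obtain ⟨w, hw⟩ := exists_iterateFrobenius_add_self_eq (n := n) hn (1 : K)
  have hσ : ∀ x, σ (iterateFrobenius K 2 n x) = iterateFrobenius K 2 n (σ x) := fun x => by
    simp [iterateFrobenius_def]
  refine hz.map_invariant_eq hσ (w := w) (by grind) fun y hy hsol => ?_
  obtain ⟨x, hx⟩ : ∃ x, iterateFrobenius K 2 n y = x * y :=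
    ⟨iterateFrobenius K 2 n y / y, by field_simp⟩
  have hxr : σ x = x := by
    apply h
    rw [trinomial_isRoot_iff]
    rw [hx, map_mul, hx] at hsol
    apply mul_right_cancel₀ hy
    grind
  -- As σ fixes x = φ(y)/y, the elements y and σ(y) have the same quotient, so φ fixes σ(y)/y.
  refine ⟨σ y / y, ?_, by field_simp⟩
  have hy' : iterateFrobenius K 2 n y ≠ 0 := (_root_.map_ne_zero _).mpr hy
  have hx0 : x ≠ 0 := by
    rintro rfl
    exact hy' (by rw [hx, zero_mul])
  rw [map_div₀, ← hσ, hx, map_mul, hxr, mul_div_mul_left _ _ hx0]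

theorem map_eq_self_of_fixes_polyMCM_roots (hn : 2 ≤ n) (ha : a ≠ 0) (hσa : σ a = a)
    (h : ∀ e, (polyMCM K n + C a).IsRoot e → σ e = e) {x : K}
    (hx : (X ^ (2 ^ n + 1) + C a * X + C a : K[X]).IsRoot x) : σ x = x := by
  have hn0 : n ≠ 0 := by omega
  have hσ : ∀ x, σ (iterateFrobenius K 2 n x) = iterateFrobenius K 2 n (σ x) := fun x => by
    simp [iterateFrobenius_def]
  obtain ⟨x₂, hx₂, hne⟩ := IsSepClosed.exists_root_notMem (separable_trinomial hn0 a ha) {x} (by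
    rw [Finset.card_singleton, add_assoc, natDegree_add_eq_left_of_natDegree_lt]
    · rw [natDegree_X_pow]
      have := Nat.one_lt_two_pow hn0
      omega
    · rw [natDegree_X_pow]
      refine natDegree_linear_le.trans_lt ?_
      have := Nat.one_lt_two_pow hn0
      omega)
  rw [Finset.mem_singleton] at hne
  have hsol : ∀ x, (X ^ (2 ^ n + 1) + C a * X + C a : K[X]).IsRoot x → ∃ y, y ≠ 0 ∧
      iterateFrobenius K 2 n y = x * y ∧
      iterateFrobenius K 2 n (iterateFrobenius K 2 n y) =
        a * (iterateFrobenius K 2 n y + y) := by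
    intro x hx
    rw [trinomial_isRoot_iff] at hx
    have hx0 : x ≠ 0 := by
      rintro rfl
      simp [ha] at hx
    obtain ⟨y, hy0, hy⟩ := exists_iterateFrobenius_eq_mul hn0 hx0
    refine ⟨y, hy0, hy, ?_⟩
    rw [hy, map_mul, hy]
    grind
  obtain ⟨y₁, hy₁, e₁, h₁⟩ := hsol x hx
  obtain ⟨y₂, hy₂, e₂, h₂⟩ := hsol x₂ hx₂
  obtain ⟨w, hw⟩ := exists_iterateFrobenius_add_self_eq (n := n) hn0 (1 : K)
  obtain ⟨c, hc, hc0, hc1⟩ := exists_iterateFrobenius_eq_self (K := K) hn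
  obtain ⟨l, hl0, hl, hσy⟩ := exists_map_eq_mul_of_invariants_fixed ha h₁ h₂ (by
    -- The Moore determinant is y₁y₂(x₂ - x), nonzero because the roots are distinct.
    have := mul_ne_zero (mul_ne_zero hy₁ hy₂) (sub_ne_zero.mpr hne)
    rw [e₁, e₂]
    convert this using 1
    grind) hσ hσa (fun z z' hz => h _ (hz.isRoot_pairInvariant ha)) (w := w) (by grind) hc hc0 hc1
  have := congrArg σ e₁
  rw [hσ, hσy, map_mul, map_mul, hl, hσy, e₁] at this
  apply mul_right_cancel₀ (mul_ne_zero hl0 hy₁)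
  linear_combination -this

end SepClosed

/-! ### Passing between the two trinomials, and the conclusion -/

theorem mem_rootSet_iff_isRoot_map {F Ω : Type*} [Field F] [Field Ω] [Algebra F Ω] {f : F[X]}
    (hf : f.Separable) {x : Ω} : x ∈ f.rootSet Ω ↔ (f.map (algebraMap F Ω)).IsRoot x := by
  rw [mem_rootSet, IsRoot, eval_map_algebraMap]
  exact and_iff_right hf.ne_zero

section CharTwo

variable {K : Type*} [Field K] [CharP K 2] {n : ℕ} {a : K}

theorem isRoot_one_add_inv (ha : a ≠ 0) {x : K}
    (hx : (X ^ (2 ^ n + 1) + C a * X + C a : K[X]).IsRoot x) :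
    x ≠ 0 ∧ (X ^ (2 ^ n + 1) + C 1 * X + C (1 / a) : K[X]).IsRoot (1 + x⁻¹) := by
  rw [trinomial_isRoot_iff] at hx ⊢
  have hx0 : x ≠ 0 := by
    rintro rfl
    simp [ha] at hx
  refine ⟨hx0, ?_⟩
  rw [map_add, map_one, map_inv₀]
  have hφ : iterateFrobenius K 2 n x ≠ 0 := (_root_.map_ne_zero _).mpr hx0
  generalize iterateFrobenius K 2 n x = y at *
  field_simp
  grind

theorem isRoot_inv_add_one (ha : a ≠ 0) {u : K}
    (hu : (X ^ (2 ^ n + 1) + C 1 * X + C (1 / a) : K[X]).IsRoot u) :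
    u + 1 ≠ 0 ∧ (X ^ (2 ^ n + 1) + C a * X + C a : K[X]).IsRoot (u + 1)⁻¹ := by
  rw [trinomial_isRoot_iff] at hu ⊢
  have hu0 : u + 1 ≠ 0 := by
    intro h0
    obtain rfl : u = 1 := CharTwo.add_eq_zero.mp h0
    rw [map_one, one_mul, CharTwo.add_self_eq_zero, zero_add] at hu
    exact one_div_ne_zero ha hu
  refine ⟨hu0, ?_⟩
  have hφ : iterateFrobenius K 2 n u + 1 ≠ 0 := by
    rw [← map_one (iterateFrobenius K 2 n), ← map_add]
    exact (_root_.map_ne_zero _).mpr hu0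
  rw [map_inv₀, map_add, map_one]
  generalize iterateFrobenius K 2 n u = y at *
  field_simp at hu ⊢
  grind

end CharTwo

theorem theorem5p1 {F : Type*} [Field F] [CharP F 2]
    {Ω : Type*} [Field Ω] [Algebra F Ω] [IsSepClosure F Ω]
    (n q : ℕ) (hq : q = 2 ^ n) (hq4 : 4 ≤ q) (a : F) (ha : a ≠ 0) :
    (((polyMCM F n + C a).map (algebraMap F Ω)).Splits ∧
      ((X ^ (q + 1) + X + C (1 / a) : F[X]).map (algebraMap F Ω)).Splits ∧
      ((X ^ (q + 1) + C a * X + C a : F[X]).map (algebraMap F Ω)).Splits) ∧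
    SF Ω (polyMCM F n + C a) = SF Ω (X ^ (q + 1) + X + C (1 / a)) ∧
    SF Ω (X ^ (q + 1) + X + C (1 / a)) = SF Ω (X ^ (q + 1) + C a * X + C a) := by
  subst hq
  have hn : 2 ≤ n := by
    by_contra! h
    interval_cases n <;> omega
  have hn0 : n ≠ 0 := by omega
  have : IsSepClosed Ω := IsSepClosure.sep_closed F
  have : CharP Ω 2 := charP_of_injective_algebraMap (algebraMap F Ω).injective 2
  have h₁ := separable_polyMCM_add_C hn0 ha
  have h₂ := separable_trinomial hn0 1 (one_div_ne_zero ha)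
  have h₃ := separable_trinomial hn0 a ha
  have hX' : (X ^ (2 ^ n + 1) + X + C (1 / a) : F[X]) =
      X ^ (2 ^ n + 1) + C 1 * X + C (1 / a) := by rw [C_1, one_mul]
  rw [hX']
  refine ⟨⟨IsSepClosed.splits_codomain _ h₁, IsSepClosed.splits_codomain _ h₂,
    IsSepClosed.splits_codomain _ h₃⟩, ?_⟩
  set b := algebraMap F Ω a with hb
  have hb0 : b ≠ 0 := (_root_.map_ne_zero _).mpr ha
  have r₁ : ∀ x, x ∈ (polyMCM F n + C a).rootSet Ω ↔ (polyMCM Ω n + C b).IsRoot x := by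
    intro x
    rw [mem_rootSet_iff_isRoot_map h₁]
    simp only [polyMCM, Polynomial.map_add, Polynomial.map_mul, Polynomial.map_pow, map_X, map_C,
      map_polyT, hb]
  have r₂ : ∀ x, x ∈ (X ^ (2 ^ n + 1) + C 1 * X + C (1 / a) : F[X]).rootSet Ω ↔
      (X ^ (2 ^ n + 1) + C 1 * X + C (1 / b) : Polynomial Ω).IsRoot x := by
    intro x
    rw [mem_rootSet_iff_isRoot_map h₂]
    simp only [Polynomial.map_add, Polynomial.map_mul, Polynomial.map_pow, map_X, map_C, map_one,
      Polynomial.map_one,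
      map_div₀, hb]
  have r₃ : ∀ x, x ∈ (X ^ (2 ^ n + 1) + C a * X + C a : F[X]).rootSet Ω ↔
      (X ^ (2 ^ n + 1) + C b * X + C b : Polynomial Ω).IsRoot x := by
    intro x
    rw [mem_rootSet_iff_isRoot_map h₃]
    simp only [Polynomial.map_add, Polynomial.map_mul, Polynomial.map_pow, map_X, map_C, hb]
  have e₂₃ : SF Ω (X ^ (2 ^ n + 1) + C 1 * X + C (1 / a)) =
      SF Ω (X ^ (2 ^ n + 1) + C a * X + C a) := by
    refine IntermediateField.adjoin_eq_adjoin_of_fixes_iff fun σ => ?_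
    simp only [r₂, r₃]
    constructor
    · intro h x hx
      obtain ⟨hx0, hu⟩ := isRoot_one_add_inv hb0 hx
      have := h _ hu
      rw [map_add, map_one, map_inv₀, add_right_inj] at this
      exact inv_injective this
    · intro h u hu
      have := h _ (isRoot_inv_add_one hb0 hu).2
      rw [map_inv₀, map_add, map_one] at this
      exact add_right_cancel (inv_injective this)
  refine ⟨?_, e₂₃⟩
  rw [e₂₃]
  refine IntermediateField.adjoin_eq_adjoin_of_fixes_iff fun σ => ?_
  simp only [r₁, r₃]
  constructor
  · exact fun h x hx => map_eq_self_of_fixes_polyMCM_roots (σ := (σ : Ω →+* Ω)) hn hb0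
      (σ.commutes a) h hx
  · exact fun h e he => map_eq_self_of_fixes_trinomial_roots (σ := (σ : Ω →+* Ω)) hn0 hb0 h he
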